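/- Let $k$ be a field and let $0<a_1<a_2<a_3$ be integers with $\gcd(a_1,a_2,a_3)=1$. Let $H=\langle a_1,a_2,a_3\rangle\subseteq\mathbb N$ be the numerical semigroup they generate, and let $$S=k[[t^{a_1},t^{a_2},t^{a_3}]]=k[[t^h : h\in H]]\subseteq k[[t]],$$ a local ring with maximal ideal $\mathfrak n$. Assume that $S$ has embedding dimension three, i.e. $\dim_{S/\mathfrak n}\mathfrak n/\mathfrak n^2=3$, and that $S$ is not Gorenstein. Then $S$ is a canonical stretched ring: $S$ is a Cohen-Macaulay local ring, and there is an irreducible ideal $I\subseteq\mathfrak n^2$ of $S$ (a proper ideal which is not the intersection of two strictly larger ideals) such that $S/I$ is a stretched Artinian local ring. Here a Noetherian local ring $(R,\mathfrak m)$ is called stretched if there is a minimal reduction $J$ of $\mathfrak m$ which is a parameter ideal of $R$ (an ideal with radical $\mathfrak m$ generated by $\dim R$ elements) and satisfies $\ell_R\big((\mathfrak m^2+J)/(\mathfrak m^3+J)\big)=1$; for Artinian $R$ this means $J=0$ and $\ell_R(\mathfrak m^2/\mathfrak m^3)=1$. -/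

import Mathlib

open IsLocalRing

/-- The ring `k[[H]] = k[[t^h : h ∈ H]] ⊆ k[[t]]` of a submonoid `H` of `ℕ`: all formal power
series `∑ c_n t^n` whose exponents with nonzero coefficient lie in `H`. For
`H = ⟨a₁, …, a_r⟩` this is `k[[t^{a₁}, …, t^{a_r}]]`. -/
def semigroupRing (k : Type*) [Field k] (H : AddSubmonoid ℕ) : Subalgebra k (PowerSeries k) where
  carrier := {f | ∀ n, PowerSeries.coeff n f ≠ 0 → n ∈ H}
  mul_mem' := by
    intro f g hf hg n hn
    rw [PowerSeries.coeff_mul] at hn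
    obtain ⟨p, hp, hne⟩ := Finset.exists_ne_zero_of_sum_ne_zero hn
    rw [← Finset.HasAntidiagonal.mem_antidiagonal.mp hp]
    exact H.add_mem (hf _ (left_ne_zero_of_mul hne)) (hg _ (right_ne_zero_of_mul hne))
  add_mem' := by
    intro f g hf hg n hn
    rw [map_add] at hn
    by_cases h : PowerSeries.coeff n f = 0
    · exact hg n (by simpa [h] using hn)
    · exact hf n h
  algebraMap_mem' := by
    intro r n hn
    rw [PowerSeries.algebraMap_apply, PowerSeries.coeff_C] at hn
    by_cases h : n = 0
    · exact h ▸ H.zero_mem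
    · simp [h] at hn

theorem semigroupRing_inv_mem {k : Type*} [Field k] {H : AddSubmonoid ℕ} {f : PowerSeries k}
    (hf : f ∈ semigroupRing k H) : f⁻¹ ∈ semigroupRing k H := by
  intro n
  induction n using Nat.strong_induction_on with
  | _ n ih =>
    intro hn
    rw [PowerSeries.coeff_inv] at hn
    by_cases h : n = 0
    · exact h ▸ H.zero_mem
    · rw [if_neg h] at hn
      obtain ⟨p, hp, hne⟩ := Finset.exists_ne_zero_of_sum_ne_zero (right_ne_zero_of_mul hn)
      by_cases hlt : p.2 < n
      · rw [if_pos hlt] at hne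
        rw [← Finset.HasAntidiagonal.mem_antidiagonal.mp hp]
        exact H.add_mem (hf _ (left_ne_zero_of_mul hne)) (ih _ hlt (right_ne_zero_of_mul hne))
      · simp [hlt] at hne

/-- An element of `k[[H]]` with nonzero constant term is a unit. -/
theorem semigroupRing_isUnit {k : Type*} [Field k] {H : AddSubmonoid ℕ} (f : semigroupRing k H)
    (hf : PowerSeries.constantCoeff (f : PowerSeries k) ≠ 0) : IsUnit f :=
  IsUnit.of_mul_eq_one ⟨(f : PowerSeries k)⁻¹, semigroupRing_inv_mem f.2⟩
    (Subtype.ext (PowerSeries.mul_inv_cancel _ hf))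

instance semigroupRing_isLocalRing (k : Type*) [Field k] (H : AddSubmonoid ℕ) :
    IsLocalRing (semigroupRing k H) := by
  refine IsLocalRing.of_isUnit_or_isUnit_of_isUnit_add fun a b hab => ?_
  by_cases ha : PowerSeries.constantCoeff (a : PowerSeries k) = 0
  · refine Or.inr (semigroupRing_isUnit b fun hb => ?_)
    have h := (hab.map (semigroupRing k H).val).map (PowerSeries.constantCoeff (R := k))
    simp [ha, hb] at h
  · exact Or.inl (semigroupRing_isUnit a ha)

/-- The embedding dimension `dim_k (𝔪 / 𝔪²)` of a local ring. -/
noncomputable def embDim (R : Type*) [CommRing R] [IsLocalRing R] : ℕ :=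
  Module.finrank (ResidueField R) (CotangentSpace R)

/-- A Gorenstein local ring: a Noetherian local ring of finite injective dimension as a module
over itself. -/
def IsGorensteinLocal (R : Type*) [CommRing R] [IsLocalRing R] : Prop :=
  IsNoetherianRing R ∧ ∃ n : ℕ, CategoryTheory.HasInjectiveDimensionLE (ModuleCat.of R R) n

/-- A Cohen-Macaulay local ring: a Noetherian local ring whose maximal ideal contains a regular
sequence of length `dim R`. -/
def IsCohenMacaulayLocal (R : Type*) [CommRing R] [IsLocalRing R] : Prop :=
  IsNoetherianRing R ∧ ∃ rs : List R, (∀ r ∈ rs, r ∈ maximalIdeal R) ∧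
    RingTheory.Sequence.IsRegular R rs ∧ (rs.length : WithBot ℕ∞) = ringKrullDim R

/-- `J` is a reduction of `I`. -/
def IsReductionOf {R : Type*} [CommRing R] (J I : Ideal R) : Prop :=
  J ≤ I ∧ ∃ n : ℕ, I ^ (n + 1) = J * I ^ n

/-- `J` is a minimal reduction of `I`: a reduction of `I` that contains no smaller one. -/
def IsMinimalReductionOf {R : Type*} [CommRing R] (J I : Ideal R) : Prop :=
  Minimal (fun K => IsReductionOf K I) J

/-- A parameter ideal: an ideal with radical the maximal ideal, generated by `dim R` elements. -/
def IsParameterIdeal {R : Type*} [CommRing R] [IsLocalRing R] (J : Ideal R) : Prop :=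
  J.radical = maximalIdeal R ∧
    ∃ rs : List R, Ideal.ofList rs = J ∧ (rs.length : WithBot ℕ∞) = ringKrullDim R

/-- A stretched local ring: some minimal reduction `J` of the maximal ideal `𝔪` is a parameter
ideal, and the module `(𝔪² + J) / (𝔪³ + J)` has length one. -/
def IsStretchedLocal (R : Type*) [CommRing R] [IsLocalRing R] : Prop :=
  IsNoetherianRing R ∧ ∃ J : Ideal R, IsMinimalReductionOf J (maximalIdeal R) ∧
    IsParameterIdeal J ∧
    Module.length R (↥(maximalIdeal R ^ 2 ⊔ J) ⧸
      (maximalIdeal R ^ 3 ⊔ J).submoduleOf (maximalIdeal R ^ 2 ⊔ J)) = 1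

/-- A canonical stretched ring: a Cohen-Macaulay local ring `(S, 𝔫)` with an irreducible ideal
`I ⊆ 𝔫²` such that `S / I` is a stretched Artinian local ring. (`InfIrred I` says that `I` is a
proper ideal which is not the intersection of two strictly larger ideals.) -/
def IsCanonicalStretched (S : Type*) [CommRing S] [IsLocalRing S] : Prop :=
  IsCohenMacaulayLocal S ∧ ∃ I : Ideal S, InfIrred I ∧ I ≤ maximalIdeal S ^ 2 ∧
    IsArtinianRing (S ⧸ I) ∧ ∃ _ : IsLocalRing (S ⧸ I), IsStretchedLocal (S ⧸ I)

/-! A linear functional `l` on `S` determines the largest ideal `I` inside its kernel. When `𝔫 ^ N ≤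
I`, the quotient `S ⧸ I` carries the nondegenerate pairing `(f, g) ↦ l (f * g)`, its socle is a
line, and `I` is irreducible. It remains to choose `l` so that `I ≤ 𝔫²` and `𝔫²/𝔫³` becomes a line
modulo `I`.

Embedding dimension three makes `a₁, a₂, a₃` irreducible in `H`
(`minimallyGenerated_of_embDim_eq_three`). Hence the only summands of `a₂ + a₃` in `H` are `0`,
`a₂`, `a₃`, `a₂ + a₃` and possibly multiples of `a₁` (`summand_of_add_eq`).

If `a₂ + a₃ = s a₁`, let `l` be the coefficient of `t^(a₂+a₃)`. Then `S ⧸ I` has basis `t^a₂`,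
`t^a₃` and `t^(i a₁)` for `i ≤ s`, so its Hilbert function is `1, 3, 1, …, 1`. Otherwise no
nontrivial summand of `a₂ + a₃` is a multiple of `a₁`. Adding the coefficient of `t^(2a₁)` to `l`
then makes `t^a₁` survive and identifies `t^(2a₁)` with `t^(a₂+a₃)`; the Hilbert function is `1, 3,
1`. In both cases `t^(2a₁)` spans `𝔫²` modulo `𝔫³ + I`. -/

theorem isArtinianRing_quotient_of_isArtinian {R : Type*} [CommRing R] (I : Ideal R)
    (h : IsArtinian R (R ⧸ I)) : IsArtinianRing (R ⧸ I) :=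
  isArtinian_of_tower R h

/-! ### Ideals, finiteness and dimension of `k[[H]]` -/

namespace SemigroupRing

open PowerSeries

variable {k : Type*} [Field k] {H : AddSubmonoid ℕ}

@[ext]
theorem ext {f g : semigroupRing k H}
    (h : ∀ n, coeff n (f : PowerSeries k) = coeff n (g : PowerSeries k)) : f = g :=
  Subtype.ext (PowerSeries.ext h)

/-- The monomial `t^h` of `k[[H]]`, for `h ∈ H`. -/
noncomputable def tpow (k : Type*) [Field k] {H : AddSubmonoid ℕ} (h : H) : semigroupRing k H :=
  ⟨X ^ (h : ℕ), fun n hn => by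
    rw [coeff_X_pow] at hn
    by_cases hh : n = h
    · exact hh ▸ h.2
    · simp [hh] at hn⟩

theorem coe_tpow (h : H) : (tpow k h : PowerSeries k) = X ^ (h : ℕ) := rfl

theorem coeff_tpow (h : H) (n : ℕ) :
    coeff n (tpow k h : PowerSeries k) = if n = h then 1 else 0 := by
  rw [coe_tpow, coeff_X_pow]

theorem coeff_mul_tpow (f : semigroupRing k H) (h : H) (n : ℕ) :
    coeff n ((f * tpow k h : semigroupRing k H) : PowerSeries k) =
      if (h : ℕ) ≤ n then coeff (n - h) (f : PowerSeries k) else 0 := by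
  rw [MulMemClass.coe_mul, coe_tpow, coeff_mul_X_pow']

theorem mem_of_coeff_ne_zero (f : semigroupRing k H) {n : ℕ}
    (h : coeff n (f : PowerSeries k) ≠ 0) : n ∈ H := f.2 n h

theorem exists_of_coeff_mul_ne_zero {f g : semigroupRing k H} {n : ℕ}
    (h : coeff n ((f * g : semigroupRing k H) : PowerSeries k) ≠ 0) :
    ∃ i j, i + j = n ∧ coeff i (f : PowerSeries k) ≠ 0 ∧ coeff j (g : PowerSeries k) ≠ 0 := by
  rw [MulMemClass.coe_mul, coeff_mul] at h
  obtain ⟨p, hp, hne⟩ := Finset.exists_ne_zero_of_sum_ne_zero h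
  exact ⟨p.1, p.2, Finset.HasAntidiagonal.mem_antidiagonal.mp hp, left_ne_zero_of_mul hne, right_ne_zero_of_mul hne⟩

/-- The ideal of power series in `k[[H]]` supported in a set `T` of exponents that is stable under
translation by `H`. -/
def supportedIn (k : Type*) [Field k] {H : AddSubmonoid ℕ} (T : Set ℕ)
    (hT : ∀ t ∈ T, ∀ h ∈ H, h + t ∈ T) : Ideal (semigroupRing k H) where
  carrier := {f | ∀ n, coeff n (f : PowerSeries k) ≠ 0 → n ∈ T}
  zero_mem' := fun n hn => by simp at hn
  add_mem' := by
    intro f g hf hg n hn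
    rw [AddMemClass.coe_add, map_add] at hn
    by_cases h : coeff n (f : PowerSeries k) = 0
    · exact hg n (by simpa [h] using hn)
    · exact hf n h
  smul_mem' := by
    intro c f hf n hn
    obtain ⟨i, j, rfl, hi, hj⟩ := exists_of_coeff_mul_ne_zero hn
    exact hT _ (hf _ hj) _ (mem_of_coeff_ne_zero c hi)

theorem mem_supportedIn {T : Set ℕ} {hT : ∀ t ∈ T, ∀ h ∈ H, h + t ∈ T} {f : semigroupRing k H} :
    f ∈ supportedIn k T hT ↔ ∀ n, coeff n (f : PowerSeries k) ≠ 0 → n ∈ T := Iff.rfl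

theorem mem_maximalIdeal {f : semigroupRing k H} :
    f ∈ maximalIdeal (semigroupRing k H) ↔ coeff 0 (f : PowerSeries k) = 0 := by
  rw [IsLocalRing.mem_maximalIdeal, mem_nonunits_iff, not_iff_comm]
  refine ⟨fun h => semigroupRing_isUnit f (by simpa using h), fun h => ?_⟩
  have := (h.map (semigroupRing k H).val).map (constantCoeff (R := k))
  simpa using this.ne_zero

theorem tpow_mem_maximalIdeal {h : H} (hh : (h : ℕ) ≠ 0) :
    tpow k h ∈ maximalIdeal (semigroupRing k H) := by
  rw [mem_maximalIdeal, coeff_tpow, if_neg (Ne.symm hh)]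

/-- A power series whose exponents all have the form `b + h` with `b ∈ B`, `h ∈ T` lies in any
product `J * K` where `J` contains the series supported in `T` and `K` the `t^b`. -/
theorem mem_mul_of_forall_exists_add (J K : Ideal (semigroupRing k H)) (T : Set ℕ)
    (hT : T ⊆ H) (hJ : ∀ f : semigroupRing k H, (∀ n, coeff n (f : PowerSeries k) ≠ 0 → n ∈ T) → f ∈ J)
    (B : Finset H) (hK : ∀ b ∈ B, tpow k b ∈ K) (f : semigroupRing k H)
    (hf : ∀ n, coeff n (f : PowerSeries k) ≠ 0 → ∃ b ∈ B, ∃ h ∈ T, n = b + h) : f ∈ J * K := by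
  classical
  induction B using Finset.induction_on generalizing f with
  | empty =>
    have : f = 0 := by
      ext n
      by_contra h
      obtain ⟨b, hb, -⟩ := hf n (by simpa using h)
      simp at hb
    exact this ▸ zero_mem _
  | insert b B hb ih =>
    -- `u * t^b` collects the terms of `f` with exponent in `b + T`; the exponents that remain come
    -- from the other elements of `B`.
    let u : semigroupRing k H :=
      ⟨PowerSeries.mk fun n => if n ∈ T then coeff (b + n) (f : PowerSeries k) else 0, by
        intro n hn
        rw [coeff_mk] at hn
        exact hT (by by_contra h; simp [h] at hn)⟩
    have hu : ∀ n, coeff n (u : PowerSeries k) = if n ∈ T then coeff (b + n) (f : PowerSeries k) else 0 :=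
      fun n => PowerSeries.coeff_mk n fun n => if n ∈ T then coeff (b + n) (f : PowerSeries k) else 0
    have huJ : u ∈ J := hJ u fun n hn => by
      rw [hu] at hn
      by_contra h
      simp [h] at hn
    have : f - u * tpow k b ∈ J * K := by
      refine ih (fun c hc => hK c (Finset.mem_insert_of_mem hc)) _ fun n hn => ?_
      rw [AddSubgroupClass.coe_sub, map_sub, coeff_mul_tpow, hu] at hn
      by_cases h : ∃ h ∈ T, n = b + h
      · obtain ⟨h, hh, rfl⟩ := h
        simp [hh] at hn
      · have hn' : coeff n (f : PowerSeries k) ≠ 0 := by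
          rintro h0
          by_cases hbn : (b : ℕ) ≤ n
          · have : n - b ∉ T := fun hh => h ⟨_, hh, by omega⟩
            simp [this, h0] at hn
          · simp [hbn, h0] at hn
        obtain ⟨c, hc, h', hh', e⟩ := hf n hn'
        rcases Finset.mem_insert.mp hc with rfl | hc
        · exact absurd ⟨h', hh', e⟩ h
        · exact ⟨c, hc, h', hh', e⟩
    have h2 := Ideal.mul_mem_mul huJ (hK b (Finset.mem_insert_self _ _))
    simpa using add_mem this h2

/-- The ideal of series of order at least `M` in `k[[H]]`. -/
def orderGE (k : Type*) [Field k] (H : AddSubmonoid ℕ) (M : ℕ) : Ideal (semigroupRing k H) :=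
  supportedIn k {n | M ≤ n} fun _ ht h _ => le_trans ht (Nat.le_add_left _ h)

theorem mem_orderGE {M : ℕ} {f : semigroupRing k H} :
    f ∈ orderGE k H M ↔ ∀ n < M, coeff n (f : PowerSeries k) = 0 := by
  rw [orderGE, mem_supportedIn]
  exact forall_congr' fun n => by rw [Set.mem_ofPred_eq, not_imp_comm, not_le]

theorem finite_quotient_of_orderGE_le {M : ℕ} {I : Ideal (semigroupRing k H)}
    (h : orderGE k H M ≤ I) : Module.Finite k (semigroupRing k H ⧸ I) := by
  let φ : semigroupRing k H →ₗ[k] (Fin M → k) :=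
    LinearMap.pi fun i => (coeff (R := k) (i : ℕ)).comp (semigroupRing k H).val.toLinearMap
  have hφ : LinearMap.ker φ ≤ (orderGE k H M).restrictScalars k := by
    intro f hf
    rw [Submodule.restrictScalars_mem, mem_orderGE]
    intro n hn
    exact congrFun (LinearMap.mem_ker.mp hf) ⟨n, hn⟩
  have h1 : Module.Finite k (semigroupRing k H ⧸ LinearMap.ker φ) :=
    Module.Finite.equiv φ.quotKerEquivRange.symm
  let ψ : (semigroupRing k H ⧸ LinearMap.ker φ) →ₗ[k] (semigroupRing k H ⧸ I) :=
    (LinearMap.ker φ).liftQ (Ideal.Quotient.mkₐ k I).toLinearMap (by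
      intro f hf
      exact Ideal.Quotient.eq_zero_iff_mem.mpr (h (hφ hf)))
  refine Module.Finite.of_surjective ψ ?_
  intro x
  obtain ⟨f, rfl⟩ := Ideal.Quotient.mk_surjective x
  exact ⟨Submodule.Quotient.mk f, rfl⟩

theorem isArtinianRing_quotient_of_orderGE_le {M : ℕ} {I : Ideal (semigroupRing k H)}
    (h : orderGE k H M ≤ I) : IsArtinianRing (semigroupRing k H ⧸ I) :=
  have := finite_quotient_of_orderGE_le h
  isArtinianRing_quotient_of_isArtinian I
    (isArtinian_of_tower k (inferInstance : IsArtinian k (semigroupRing k H ⧸ I)))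

/-- If `H` is cofinite in `ℕ`, then a nonzero ideal contains all series of high order. -/
theorem exists_orderGE_le {c : ℕ} (hc : ∀ n ≥ c, n ∈ H) {I : Ideal (semigroupRing k H)}
    (hI : I ≠ ⊥) : ∃ M, orderGE k H M ≤ I := by
  obtain ⟨f, hfI, hf⟩ := Submodule.exists_mem_ne_zero_of_ne_bot hI
  have hf' : (f : PowerSeries k) ≠ 0 := by simpa using hf
  obtain ⟨v, u, hu⟩ : ∃ (v : ℕ) (u : (PowerSeries k)ˣ), (f : PowerSeries k) = X ^ v * (u : PowerSeries k) := by
    obtain ⟨v, hv⟩ := IsDiscreteValuationRing.associated_pow_irreducible hf' X_irreducible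
    obtain ⟨u, hu⟩ := hv.symm
    exact ⟨v, u, hu.symm⟩
  refine ⟨v + c, fun g hg => ?_⟩
  obtain ⟨w, hw⟩ : X ^ (v + c) ∣ (g : PowerSeries k) := X_pow_dvd_iff.mpr (mem_orderGE.mp hg)
  -- With `f = X^v u` and `g = X^(v+c) w`, the quotient `g / f` has order at least `c`, so all its
  -- exponents lie in `H`.
  let q : semigroupRing k H := ⟨X ^ c * (w * ((u⁻¹ : (PowerSeries k)ˣ) : PowerSeries k)), by
    intro n hn
    rw [coeff_X_pow_mul'] at hn
    exact hc n (by by_contra h; simp [h] at hn)⟩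
  have : g = q * f := by
    refine Subtype.ext ?_
    have h1 : (g : PowerSeries k) = X ^ c * (w * ((u⁻¹ : (PowerSeries k)ˣ) : PowerSeries k)) * (X ^ v * (u : PowerSeries k)) := by
      rw [hw, pow_add]
      linear_combination (-(X ^ c * w * X ^ v)) * u.inv_mul
    rw [h1, ← hu]
    rfl
  exact this ▸ I.mul_mem_left _ hfI

/-- A nonzero ideal contains some `f ≠ 0`, and the quotient by `(f)` is finite-dimensional over `k`;
finite generation lifts from there. -/
theorem isNoetherianRing {c : ℕ} (hc : ∀ n ≥ c, n ∈ H) : IsNoetherianRing (semigroupRing k H) := by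
  rw [isNoetherianRing_iff_ideal_fg]
  intro J
  by_cases hJ : J = ⊥
  · exact hJ ▸ Submodule.fg_bot
  obtain ⟨f, hfJ, hf⟩ := Submodule.exists_mem_ne_zero_of_ne_bot hJ
  obtain ⟨M, hM⟩ := exists_orderGE_le hc (I := Ideal.span {f}) (by simpa using hf)
  have h1 := finite_quotient_of_orderGE_le hM
  have h2 : IsNoetherian (semigroupRing k H) (semigroupRing k H ⧸ Ideal.span {f}) :=
    isNoetherian_of_tower k inferInstance
  refine Submodule.fg_of_fg_map_of_fg_inf_ker (Submodule.mkQ (Ideal.span {f})) (h2.noetherian _) ?_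
  rw [Submodule.ker_mkQ, inf_eq_right.mpr ((Ideal.span_singleton_le_iff_mem _).mpr hfJ)]
  exact ⟨{f}, by simp⟩

/-- The quotient by a nonzero prime is an Artinian domain, hence a field. The nonunit `t^(c+1)`
shows that the ring itself is not a field; the exponent is `c + 1` because `c` may be `0`. -/
theorem ringKrullDim_eq_one {c : ℕ} (hc : ∀ n ≥ c, n ∈ H) : ringKrullDim (semigroupRing k H) = 1 := by
  have hle : Ring.KrullDimLE 1 (semigroupRing k H) := by
    refine Ring.KrullDimLE.mk₁' fun I hI hp => ?_
    obtain ⟨M, hM⟩ := exists_orderGE_le hc hI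
    have := isArtinianRing_quotient_of_orderGE_le hM
    exact Ideal.Quotient.maximal_of_isField _ (IsArtinianRing.isField_of_isDomain (semigroupRing k H ⧸ I))
  refine le_antisymm (Ring.krullDimLE_iff.mp hle) ?_
  rw [← not_lt]
  intro hlt
  have h0 : ringKrullDim (semigroupRing k H) ≤ (0 : ℕ) := by
    exact ENat.WithBot.lt_add_one_iff.mp (by simpa using hlt)
  have := Ring.krullDimLE_iff.mpr h0
  have hF : IsField (semigroupRing k H) := Ring.KrullDimLE.isField_of_isDomain
  have hm := IsLocalRing.isField_iff_maximalIdeal_eq.mp hF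
  have hx : tpow k (⟨c + 1, hc _ (by omega)⟩ : H) ∈ maximalIdeal (semigroupRing k H) :=
    tpow_mem_maximalIdeal (by simp)
  rw [hm, Ideal.mem_bot] at hx
  have := coeff_tpow (k := k) (⟨c + 1, hc _ (by omega)⟩ : H) (c + 1)
  simp [hx] at this

theorem isCohenMacaulayLocal {c : ℕ} (hc : ∀ n ≥ c, n ∈ H) :
    IsCohenMacaulayLocal (semigroupRing k H) := by
  have hN := isNoetherianRing (k := k) hc
  set x := tpow k (⟨c + 1, hc _ (by omega)⟩ : H) with hxdef
  have hx : x ∈ maximalIdeal (semigroupRing k H) := tpow_mem_maximalIdeal (by simp)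
  have hx0 : x ≠ 0 := fun h => by
    have := coeff_tpow (k := k) (⟨c + 1, hc _ (by omega)⟩ : H) (c + 1)
    simp [← hxdef, h] at this
  refine ⟨hN, [x], by simpa using hx, ?_, by simp [ringKrullDim_eq_one hc]⟩
  rw [IsLocalRing.isRegular_iff_isWeaklyRegular_of_subset_maximalIdeal (by simpa using hx),
    RingTheory.Sequence.isWeaklyRegular_singleton_iff]
  exact isSMulRegular_iff_right_eq_zero_of_smul.mpr fun y hy => by
    simpa [hx0] using hy

end SemigroupRing

/-! ### Irreducible ideals from functionals, and stretched quotients -/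

section FunctionalIdeal

variable {k S : Type*} [Field k] [CommRing S] [Algebra k S]

/-- The largest ideal contained in the kernel of a linear functional. -/
def functionalIdeal (l : S →ₗ[k] k) : Ideal S where
  carrier := {f | ∀ g, l (g * f) = 0}
  zero_mem' := by simp
  add_mem' := by
    intro a b ha hb g
    rw [mul_add, map_add, ha, hb, add_zero]
  smul_mem' := by
    intro c f hf g
    rw [smul_eq_mul, ← mul_assoc]
    exact hf _

theorem functionalIdeal_ne_top {l : S →ₗ[k] k} (hl : l ≠ 0) : functionalIdeal l ≠ ⊤ := by
  intro h
  refine hl (LinearMap.ext fun g => ?_)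
  have h1 : (1 : S) ∈ functionalIdeal l := h ▸ Submodule.mem_top
  simpa using h1 g

variable [IsLocalRing S]

/-- Over a local ring with residue field `k`, an ideal strictly larger than the ideal of a
functional `l` contains an element of the socle modulo that ideal on which `l` does not vanish. -/
theorem exists_socle_of_functionalIdeal_lt
    (hres : ∀ f : S, ∃ c : k, f - algebraMap k S c ∈ maximalIdeal S)
    {l : S →ₗ[k] k} {N : ℕ} (hN : maximalIdeal S ^ N ≤ functionalIdeal l) {J : Ideal S}
    (hJ : functionalIdeal l < J) :
    ∃ s ∈ J, l s ≠ 0 ∧ ∀ g ∈ maximalIdeal S, g * s ∈ functionalIdeal l := by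
  classical
  obtain ⟨f, hfJ, hf⟩ := SetLike.exists_of_lt hJ
  -- The last power of `𝔫` that does not carry `f` into the ideal produces the socle element `g *
  -- f`.
  have hex : ∃ n, ∀ g ∈ maximalIdeal S ^ n, g * f ∈ functionalIdeal l :=
    ⟨N, fun g hg => Ideal.mul_mem_right _ _ (hN hg)⟩
  obtain ⟨n, hn⟩ : ∃ n, Nat.find hex = n + 1 := by
    refine Nat.exists_eq_succ_of_ne_zero fun h0 => hf ?_
    have := Nat.find_spec hex
    rw [h0] at this
    simpa using this 1 (by simp)
  have hmin := Nat.find_min hex (m := n) (by omega)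
  push Not at hmin
  obtain ⟨g, hg, hgf⟩ := hmin
  have hsoc : ∀ g' ∈ maximalIdeal S, g' * (g * f) ∈ functionalIdeal l := by
    intro g' hg'
    rw [← mul_assoc]
    refine (hn ▸ Nat.find_spec hex) _ ?_
    rw [pow_succ']
    exact Ideal.mul_mem_mul hg' hg
  refine ⟨g * f, J.mul_mem_left _ hfJ, fun h0 => hgf fun g' => ?_, hsoc⟩
  -- On a socle element, `g'` acts through its residue `c`; so if `l` vanished there, the element
  -- would lie in the ideal.
  obtain ⟨c, hc⟩ := hres g'
  have h1 := hsoc _ hc 1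
  have h2 : g' * (g * f) = 1 * ((g' - algebraMap k S c) * (g * f)) + c • (g * f) := by
    rw [Algebra.smul_def]
    ring
  rw [h2, map_add, h1, map_smul, h0, smul_zero, add_zero]

/-- Two strictly larger ideals contain socle elements `s` and `t` on which `l` is nonzero. The
combination `l s • t - l t • s` is a socle element killed by `l`, so it lies in the ideal, and `t`
falls into both larger ideals. -/
theorem infIrred_functionalIdeal
    (hres : ∀ f : S, ∃ c : k, f - algebraMap k S c ∈ maximalIdeal S)
    {l : S →ₗ[k] k} (hl : l ≠ 0) {N : ℕ} (hN : maximalIdeal S ^ N ≤ functionalIdeal l) :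
    InfIrred (functionalIdeal l) := by
  refine ⟨fun h => functionalIdeal_ne_top hl (isMax_iff_eq_top.mp h), fun J K hJK => ?_⟩
  by_contra! hne
  have hJ : functionalIdeal l < J := lt_of_le_of_ne (hJK ▸ inf_le_left) (Ne.symm hne.1)
  have hK : functionalIdeal l < K := lt_of_le_of_ne (hJK ▸ inf_le_right) (Ne.symm hne.2)
  obtain ⟨s, hsJ, hs, hs'⟩ := exists_socle_of_functionalIdeal_lt hres hN hJ
  obtain ⟨t, htK, ht, ht'⟩ := exists_socle_of_functionalIdeal_lt hres hN hK
  have hd : l s • t - l t • s ∈ functionalIdeal l := by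
    intro g
    obtain ⟨c, hc⟩ := hres g
    have h1 := ht' _ hc 1
    have h2 := hs' _ hc 1
    have h3 : g * (l s • t - l t • s) = l s • (1 * ((g - algebraMap k S c) * t)) -
        l t • (1 * ((g - algebraMap k S c) * s)) + c • (l s • t - l t • s) := by
      simp only [Algebra.smul_def]
      ring
    rw [h3]
    simp only [map_add, map_sub, map_smul, h1, h2, smul_eq_mul]
    ring
  have htJ : t ∈ J := by
    have h1 : l s • t ∈ J := by
      have h2 : l t • s ∈ J := by
        rw [Algebra.smul_def]
        exact J.mul_mem_left _ hsJ
      simpa using add_mem (hJ.le hd) h2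
    have h3 : t = (l s)⁻¹ • (l s • t) := by rw [smul_smul, inv_mul_cancel₀ hs, one_smul]
    rw [h3, Algebra.smul_def]
    exact J.mul_mem_left _ h1
  have : t ∈ functionalIdeal l := hJK ▸ (⟨htJ, htK⟩ : t ∈ J ⊓ K)
  exact ht (by simpa using this 1)

end FunctionalIdeal

/-- An Artinian local quotient `S ⧸ I` is stretched if `𝔫² = 𝔫³ + I + (y)` up to scalars
representing the residue field and `y ∈ 𝔫²` is not in `𝔫³ + I`. -/
theorem isStretchedLocal_quotient {k S : Type*} [Field k] [CommRing S] [Algebra k S]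
    [IsLocalRing S] (I : Ideal S) [IsArtinianRing (S ⧸ I)] [IsLocalRing (S ⧸ I)]
    {y : S} (hy : y ∈ maximalIdeal S ^ 2) (hy' : y ∉ maximalIdeal S ^ 3 ⊔ I)
    (hspan : ∀ f ∈ maximalIdeal S ^ 2, ∃ c : k, f - c • y ∈ maximalIdeal S ^ 3 ⊔ I) :
    IsStretchedLocal (S ⧸ I) := by
  obtain ⟨N, hN⟩ : IsNilpotent (maximalIdeal (S ⧸ I)) := by
    rw [← Ring.KrullDimLE.nilradical_eq_maximalIdeal]
    exact IsArtinianRing.isNilpotent_nilradical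
  -- As `𝔪` is nilpotent, the zero ideal is a reduction, and it is generated by the empty list.
  refine ⟨inferInstance, ⊥, ⟨⟨bot_le, N, ?_⟩, fun _ _ _ => bot_le⟩,
    ⟨Ring.KrullDimLE.radical_eq_maximalIdeal _ bot_ne_top, [], by simp, ?_⟩, ?_⟩
  · rw [pow_succ, hN, Ideal.bot_mul, Ideal.zero_eq_bot, Ideal.bot_mul]
  · simpa using (ringKrullDimZero_iff_ringKrullDim_eq_zero.mp
      (inferInstance : Ring.KrullDimLE 0 (S ⧸ I))).symm
  rw [sup_bot_eq, sup_bot_eq, Module.length_eq_one_iff]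
  refine (covBy_iff_quot_is_simple (Ideal.pow_le_pow_right (by norm_num))).mp ?_
  have hmk := Ideal.Quotient.mk_surjective (I := I)
  have hpow : ∀ n, ∀ f, Ideal.Quotient.mk I f ∈ maximalIdeal (S ⧸ I) ^ n ↔
      f ∈ maximalIdeal S ^ n ⊔ I := by
    intro n f
    rw [← IsLocalRing.map_maximalIdeal_of_surjective _ hmk, ← Ideal.map_pow, ← Ideal.mem_comap,
      Ideal.comap_map_of_surjective _ hmk, ← RingHom.ker_eq_comap_bot, Ideal.mk_ker]
  refine ⟨lt_of_le_of_ne (Ideal.pow_le_pow_right (by norm_num)) fun h => hy' ?_, ?_⟩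
  · rw [← hpow, h, hpow]
    exact Ideal.mem_sup_left hy
  intro K hK hK2
  refine hK2.not_ge ?_
  have hspan' : ∀ x ∈ maximalIdeal (S ⧸ I) ^ 2, ∃ c : k,
      x - Ideal.Quotient.mk I (algebraMap k S c * y) ∈ maximalIdeal (S ⧸ I) ^ 3 := by
    intro x hx
    obtain ⟨f, rfl⟩ := hmk x
    rw [hpow] at hx
    obtain ⟨g, hg, i, hi, rfl⟩ := Submodule.mem_sup.mp hx
    obtain ⟨c, hc⟩ := hspan g hg
    refine ⟨c, ?_⟩
    rw [← map_sub, hpow, ← Algebra.smul_def, add_sub_right_comm]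
    exact add_mem hc (Ideal.mem_sup_right hi)
  -- An element of `K` outside `𝔪³` is a nonzero multiple of `y` modulo `𝔪³`, which puts `y`, hence
  -- all of `𝔪²`, in `K`.
  obtain ⟨x, hxK, hx⟩ := SetLike.exists_of_lt hK
  obtain ⟨c, hc⟩ := hspan' x (hK2.le hxK)
  have hc0 : c ≠ 0 := by
    rintro rfl
    exact hx (by simpa using hc)
  have hyK : Ideal.Quotient.mk I y ∈ K := by
    have h1 : Ideal.Quotient.mk I (algebraMap k S c * y) ∈ K := by
      simpa using sub_mem hxK (hK.le hc)
    have h2 := Ideal.mul_mem_left K (Ideal.Quotient.mk I (algebraMap k S c⁻¹)) h1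
    rwa [← map_mul, ← mul_assoc, ← map_mul, inv_mul_cancel₀ hc0, map_one, one_mul] at h2
  intro z hz
  obtain ⟨d, hd⟩ := hspan' z hz
  have h1 : Ideal.Quotient.mk I (algebraMap k S d * y) ∈ K := by
    rw [map_mul]
    exact Ideal.mul_mem_left K _ hyK
  simpa using add_mem (hK.le hd) h1

/-- A sufficient criterion for being a canonical stretched ring, with the irreducible ideal given
by a linear functional. -/
theorem isCanonicalStretched_of_functional {k S : Type*} [Field k] [CommRing S] [Algebra k S]
    [IsLocalRing S] (hCM : IsCohenMacaulayLocal S)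
    (hres : ∀ f : S, ∃ c : k, f - algebraMap k S c ∈ maximalIdeal S)
    {l : S →ₗ[k] k} (hl : l ≠ 0) (hArt : IsArtinianRing (S ⧸ functionalIdeal l))
    (hI : functionalIdeal l ≤ maximalIdeal S ^ 2) {y : S} (hy : y ∈ maximalIdeal S ^ 2)
    (hy' : y ∉ maximalIdeal S ^ 3 ⊔ functionalIdeal l)
    (hspan : ∀ f ∈ maximalIdeal S ^ 2, ∃ c : k,
      f - c • y ∈ maximalIdeal S ^ 3 ⊔ functionalIdeal l) :
    IsCanonicalStretched S := by
  have hnt : Nontrivial (S ⧸ functionalIdeal l) :=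
    Ideal.Quotient.nontrivial_iff.mpr (functionalIdeal_ne_top hl)
  have hloc : IsLocalRing (S ⧸ functionalIdeal l) :=
    IsLocalRing.of_surjective' (Ideal.Quotient.mk _) Ideal.Quotient.mk_surjective
  obtain ⟨N, hN⟩ : IsNilpotent (maximalIdeal (S ⧸ functionalIdeal l)) := by
    rw [← Ring.KrullDimLE.nilradical_eq_maximalIdeal]
    exact IsArtinianRing.isNilpotent_nilradical
  have hN' : maximalIdeal S ^ N ≤ functionalIdeal l := by
    rw [← IsLocalRing.map_maximalIdeal_of_surjective _ Ideal.Quotient.mk_surjective,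
      ← Ideal.map_pow, Ideal.zero_eq_bot, Ideal.map_eq_bot_iff_le_ker, Ideal.mk_ker] at hN
    exact hN
  exact ⟨hCM, functionalIdeal l, infIrred_functionalIdeal hres hl hN', hI, hArt, hloc,
    isStretchedLocal_quotient _ hy hy' hspan⟩

/-- The numerical data of a submonoid of `ℕ` minimally generated by `a₁ < a₂ < a₃`. -/
structure MinimallyGenerated (H : AddSubmonoid ℕ) (a₁ a₂ a₃ : ℕ) : Prop where
  pos : 0 < a₁
  lt₁₂ : a₁ < a₂
  lt₂₃ : a₂ < a₃
  mem₁ : a₁ ∈ H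
  mem₂ : a₂ ∈ H
  mem₃ : a₃ ∈ H
  gen : ∀ h ∈ H, h = 0 ∨ ∃ r ∈ H, h = a₁ + r ∨ h = a₂ + r ∨ h = a₃ + r
  irred₁ : ∀ h ∈ H, ∀ h' ∈ H, h + h' = a₁ → h = 0 ∨ h' = 0
  irred₂ : ∀ h ∈ H, ∀ h' ∈ H, h + h' = a₂ → h = 0 ∨ h' = 0
  irred₃ : ∀ h ∈ H, ∀ h' ∈ H, h + h' = a₃ → h = 0 ∨ h' = 0

/-! ### Factorizations of `2a₁` and `a₂ + a₃` -/

namespace MinimallyGenerated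

variable {H : AddSubmonoid ℕ} {a₁ a₂ a₃ : ℕ}

theorem le_of_mem (hH : MinimallyGenerated H a₁ a₂ a₃) {h : ℕ} (hh : h ∈ H) (h0 : h ≠ 0) : a₁ ≤ h := by
  obtain h | ⟨r, -, h⟩ := hH.gen h hh
  · exact absurd h h0
  · have := hH.lt₁₂
    have := hH.lt₂₃
    omega

theorem mul_mem (hH : MinimallyGenerated H a₁ a₂ a₃) (i : ℕ) : i * a₁ ∈ H := by
  simpa using H.nsmul_mem hH.mem₁ i

theorem eq_zero_or_eq_of_add_eq_two_mul (hH : MinimallyGenerated H a₁ a₂ a₃) {h h' : ℕ} (hh : h ∈ H) (hh' : h' ∈ H)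
    (e : h + h' = 2 * a₁) : h = 0 ∨ h = a₁ ∨ h = 2 * a₁ := by
  by_cases h0 : h = 0
  · exact Or.inl h0
  by_cases h0' : h' = 0
  · omega
  have := hH.le_of_mem hh h0
  have := hH.le_of_mem hh' h0'
  omega

theorem ne_mul₂ (hH : MinimallyGenerated H a₁ a₂ a₃) (i : ℕ) : a₂ ≠ i * a₁ := by
  intro e
  have h1 := hH.pos
  have h2 := hH.lt₁₂
  obtain _ | _ | i := i
  · omega
  · omega
  · have := hH.irred₂ a₁ hH.mem₁ ((i + 1) * a₁) (hH.mul_mem _) (by rw [e]; ring)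
    have h3 : 0 < (i + 1) * a₁ := by positivity
    omega

theorem ne_mul₃ (hH : MinimallyGenerated H a₁ a₂ a₃) (i : ℕ) : a₃ ≠ i * a₁ := by
  intro e
  have h1 := hH.pos
  have h2 := hH.lt₁₂
  have h3 := hH.lt₂₃
  obtain _ | _ | i := i
  · omega
  · omega
  · have := hH.irred₃ a₁ hH.mem₁ ((i + 1) * a₁) (hH.mul_mem _) (by rw [e]; ring)
    have h3 : 0 < (i + 1) * a₁ := by positivity
    omega

/-- Once a copy of `a₁` is split off, neither `a₂` nor `a₃` can occur in `h`: cancelling it would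
write the other generator as `m a₁` plus an element of `H`, against irreducibility. -/
theorem exists_eq_mul_of_add_eq (hH : MinimallyGenerated H a₁ a₂ a₃) {m h h' : ℕ} (hm : 0 < m)
    (hh : h ∈ H) (hh' : h' ∈ H) (e : h + h' + m * a₁ = a₂ + a₃) : ∃ i, h = i * a₁ := by
  induction h using Nat.strong_induction_on generalizing m with
  | _ h ih =>
    have h1 := hH.pos
    have h2 := hH.lt₁₂
    have h3 : 0 < m * a₁ := by positivity
    obtain h0 | ⟨r, hr, h0 | h0 | h0⟩ := hH.gen h hh
    · exact ⟨0, by omega⟩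
    · obtain ⟨i, hi⟩ := @ih r (by omega) (m + 1) (by omega) hr (by rw [← e, h0]; ring)
      exact ⟨i + 1, by rw [h0, hi]; ring⟩
    · have h4 := hH.irred₃ _ (hH.mul_mem m) (r + h') (H.add_mem hr hh') (by omega)
      exact absurd (by omega) (hH.ne_mul₃ m)
    · have h4 := hH.irred₂ _ (hH.mul_mem m) (r + h') (H.add_mem hr hh') (by omega)
      exact absurd (by omega) (hH.ne_mul₂ m)

/-- The summands of `a₂ + a₃` in the semigroup. -/
theorem summand_of_add_eq (hH : MinimallyGenerated H a₁ a₂ a₃) {h h' : ℕ} (hh : h ∈ H)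
    (hh' : h' ∈ H) (e : h + h' = a₂ + a₃) :
    h = 0 ∨ h = a₂ ∨ h = a₃ ∨ h' = 0 ∨ ∃ i, 0 < i ∧ h = i * a₁ := by
  obtain h0 | ⟨r, hr, h0 | h0 | h0⟩ := hH.gen h hh
  · exact Or.inl h0
  · obtain ⟨i, hi⟩ := hH.exists_eq_mul_of_add_eq one_pos hr hh' (by omega)
    exact Or.inr (Or.inr (Or.inr (Or.inr ⟨i + 1, by omega, by rw [h0, hi]; ring⟩)))
  · have := hH.irred₃ r hr h' hh' (by omega)
    omega
  · have := hH.irred₂ r hr h' hh' (by omega)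
    omega

/-- If `a₂ + a₃` is not a multiple of `a₁`, it has only one factorization. -/
theorem summand_of_add_eq_of_ne (hH : MinimallyGenerated H a₁ a₂ a₃)
    (hne : ∀ s, a₂ + a₃ ≠ s * a₁) {h h' : ℕ} (hh : h ∈ H) (hh' : h' ∈ H) (e : h + h' = a₂ + a₃) :
    h = 0 ∨ h = a₂ ∨ h = a₃ ∨ h' = 0 := by
  obtain h0 | h0 | h0 | h0 | ⟨i, hi, h0⟩ := hH.summand_of_add_eq hh hh' e
  · exact Or.inl h0
  · exact Or.inr (Or.inl h0)
  · exact Or.inr (Or.inr (Or.inl h0))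
  · exact Or.inr (Or.inr (Or.inr h0))
  · obtain ⟨j, hj⟩ := hH.exists_eq_mul_of_add_eq hi hh' H.zero_mem (by omega)
    exact absurd (by rw [← e, h0, hj]; ring) (hne (i + j))

/-- `a₂ + a₃` is not a sum of three nonzero elements, unless it is a multiple of `a₁`. -/
theorem add_add_ne_of_ne (hH : MinimallyGenerated H a₁ a₂ a₃) (hne : ∀ s, a₂ + a₃ ≠ s * a₁)
    {i j l : ℕ} (hi : i ∈ H) (hj : j ∈ H) (hl : l ∈ H) (hi0 : i ≠ 0) (hj0 : j ≠ 0) (hl0 : l ≠ 0) :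
    i + j + l ≠ a₂ + a₃ := by
  intro e
  obtain h | h | h | h := hH.summand_of_add_eq_of_ne hne hi (H.add_mem hj hl) (by omega)
  · omega
  · have := hH.irred₃ j hj l hl (by omega)
    omega
  · have := hH.irred₂ j hj l hl (by omega)
    omega
  · omega

end MinimallyGenerated

/-! ### Exponents of series in `𝔫²` and `𝔫³` -/

namespace SemigroupRing

open PowerSeries

variable {k : Type*} [Field k] {H : AddSubmonoid ℕ} {a₁ a₂ a₃ : ℕ}

/-- The functional taking the `n`-th coefficient. -/
noncomputable def coeffL (k : Type*) [Field k] (H : AddSubmonoid ℕ) (n : ℕ) :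
    semigroupRing k H →ₗ[k] k :=
  (coeff (R := k) n).comp (semigroupRing k H).val.toLinearMap

theorem coeffL_apply (n : ℕ) (f : semigroupRing k H) :
    coeffL k H n f = coeff n (f : PowerSeries k) := rfl

theorem coeffL_tpow (h : H) (n : ℕ) : coeffL k H n (tpow k h) = if n = h then 1 else 0 :=
  coeff_tpow h n

theorem coeffL_tpow_mul (f : semigroupRing k H) (h : H) (n : ℕ) :
    coeffL k H n (tpow k h * f) = if (h : ℕ) ≤ n then coeffL k H (n - h) f else 0 := by
  rw [mul_comm]
  exact coeff_mul_tpow f h n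

theorem mem_of_coeffL_ne_zero {f : semigroupRing k H} {n : ℕ} (h : coeffL k H n f ≠ 0) : n ∈ H :=
  mem_of_coeff_ne_zero f h

theorem exists_of_coeffL_mul_ne_zero {f g : semigroupRing k H} {n : ℕ}
    (h : coeffL k H n (f * g) ≠ 0) :
    ∃ i j, i + j = n ∧ coeffL k H i f ≠ 0 ∧ coeffL k H j g ≠ 0 :=
  exists_of_coeff_mul_ne_zero h

theorem exists_sub_algebraMap_mem_maximalIdeal (f : semigroupRing k H) :
    ∃ c : k, f - algebraMap k _ c ∈ maximalIdeal (semigroupRing k H) := by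
  refine ⟨coeff 0 (f : PowerSeries k), mem_maximalIdeal.mpr ?_⟩
  have : ((algebraMap k (semigroupRing k H) (coeff 0 (f : PowerSeries k)) : semigroupRing k H) :
      PowerSeries k) = C (coeff 0 (f : PowerSeries k)) := rfl
  rw [AddSubgroupClass.coe_sub, map_sub, this]
  simp

/-- Sums of two nonzero elements of `H` are stable under translation by `H`, so the series supported
on them form an ideal, which contains every product of two elements of `𝔫`. -/
theorem exists_add_of_mem_sq {f : semigroupRing k H} (hf : f ∈ maximalIdeal (semigroupRing k H) ^ 2)
    {n : ℕ} (hn : coeffL k H n f ≠ 0) :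
    ∃ i ∈ H, ∃ j ∈ H, i ≠ 0 ∧ j ≠ 0 ∧ n = i + j := by
  let T : Set ℕ := {n | ∃ i ∈ H, ∃ j ∈ H, i ≠ 0 ∧ j ≠ 0 ∧ n = i + j}
  have hT : ∀ t ∈ T, ∀ h ∈ H, h + t ∈ T := by
    rintro t ⟨i, hi, j, hj, hi0, hj0, rfl⟩ h hh
    exact ⟨h + i, H.add_mem hh hi, j, hj, by omega, hj0, by omega⟩
  have hle : maximalIdeal (semigroupRing k H) ^ 2 ≤ supportedIn k T hT := by
    rw [pow_two, Ideal.mul_le]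
    intro r hr s hs
    rw [mem_supportedIn]
    intro n hn
    obtain ⟨i, j, rfl, hi, hj⟩ := exists_of_coeff_mul_ne_zero hn
    rw [mem_maximalIdeal] at hr hs
    exact ⟨i, mem_of_coeff_ne_zero r hi, j, mem_of_coeff_ne_zero s hj,
      fun h => hi (h ▸ hr), fun h => hj (h ▸ hs), rfl⟩
  exact mem_supportedIn.mp (hle hf) n hn

theorem exists_add_add_of_mem_cube {f : semigroupRing k H}
    (hf : f ∈ maximalIdeal (semigroupRing k H) ^ 3) {n : ℕ} (hn : coeffL k H n f ≠ 0) :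
    ∃ i ∈ H, ∃ j ∈ H, ∃ l ∈ H, i ≠ 0 ∧ j ≠ 0 ∧ l ≠ 0 ∧ n = i + j + l := by
  let T : Set ℕ := {n | ∃ i ∈ H, ∃ j ∈ H, ∃ l ∈ H, i ≠ 0 ∧ j ≠ 0 ∧ l ≠ 0 ∧ n = i + j + l}
  have hT : ∀ t ∈ T, ∀ h ∈ H, h + t ∈ T := by
    rintro t ⟨i, hi, j, hj, l, hl, hi0, hj0, hl0, rfl⟩ h hh
    exact ⟨h + i, H.add_mem hh hi, j, hj, l, hl, by omega, hj0, hl0, by omega⟩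
  have hle : maximalIdeal (semigroupRing k H) ^ 3 ≤ supportedIn k T hT := by
    rw [pow_succ, Ideal.mul_le]
    intro r hr s hs
    rw [mem_supportedIn]
    intro n hn
    obtain ⟨i, l, rfl, hi, hl⟩ := exists_of_coeff_mul_ne_zero hn
    rw [mem_maximalIdeal] at hs
    obtain ⟨i', hi', j, hj, hi0, hj0, rfl⟩ := exists_add_of_mem_sq hr hi
    exact ⟨i', hi', j, hj, l, mem_of_coeff_ne_zero s hl, hi0, hj0, fun h => hl (h ▸ hs), rfl⟩
  exact mem_supportedIn.mp (hle hf) n hn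

/-- Infinitely many exponents may occur, but each is a generator plus a nonzero element of `H`, so
three products suffice. -/
theorem mem_sq_of_forall (hH : MinimallyGenerated H a₁ a₂ a₃) {f : semigroupRing k H}
    (hf : ∀ n, coeffL k H n f ≠ 0 → ∃ i ∈ H, ∃ j ∈ H, i ≠ 0 ∧ j ≠ 0 ∧ n = i + j) :
    f ∈ maximalIdeal (semigroupRing k H) ^ 2 := by
  classical
  have h1 := hH.pos
  have h2 := hH.lt₁₂
  have h3 := hH.lt₂₃
  rw [pow_two]
  refine mem_mul_of_forall_exists_add _ _ {n | n ∈ H ∧ n ≠ 0} (fun n hn => hn.1) ?_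
    {⟨a₁, hH.mem₁⟩, ⟨a₂, hH.mem₂⟩, ⟨a₃, hH.mem₃⟩} ?_ f ?_
  · intro g hg
    rw [mem_maximalIdeal]
    by_contra h
    exact (hg 0 h).2 rfl
  · intro b hb
    refine tpow_mem_maximalIdeal ?_
    simp only [Finset.mem_insert, Finset.mem_singleton] at hb
    rcases hb with rfl | rfl | rfl <;> simp only [] <;> omega
  · intro n hn
    obtain ⟨i, hi, j, hj, hi0, hj0, rfl⟩ := hf n hn
    obtain h0 | ⟨r, hr, h0 | h0 | h0⟩ := hH.gen i hi
    · exact absurd h0 hi0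
    · exact ⟨⟨a₁, hH.mem₁⟩, by simp, r + j, ⟨H.add_mem hr hj, by omega⟩, by simp only []; omega⟩
    · exact ⟨⟨a₂, hH.mem₂⟩, by simp, r + j, ⟨H.add_mem hr hj, by omega⟩, by simp only []; omega⟩
    · exact ⟨⟨a₃, hH.mem₃⟩, by simp, r + j, ⟨H.add_mem hr hj, by omega⟩, by simp only []; omega⟩

theorem mem_sq_of_coeff_eq_zero (hH : MinimallyGenerated H a₁ a₂ a₃) {f : semigroupRing k H}
    (h0 : coeffL k H 0 f = 0) (h1 : coeffL k H a₁ f = 0) (h2 : coeffL k H a₂ f = 0)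
    (h3 : coeffL k H a₃ f = 0) : f ∈ maximalIdeal (semigroupRing k H) ^ 2 := by
  refine mem_sq_of_forall hH fun n hn => ?_
  have hp := hH.pos
  have h12 := hH.lt₁₂
  have h23 := hH.lt₂₃
  obtain rfl | ⟨r, hr, h | h | h⟩ := hH.gen n (mem_of_coeffL_ne_zero hn)
  · exact absurd h0 hn
  · refine ⟨a₁, hH.mem₁, r, hr, by omega, ?_, h⟩
    rintro rfl
    exact hn (h ▸ h1)
  · refine ⟨a₂, hH.mem₂, r, hr, by omega, ?_, h⟩
    rintro rfl
    exact hn (h ▸ h2)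
  · refine ⟨a₃, hH.mem₃, r, hr, by omega, ?_, h⟩
    rintro rfl
    exact hn (h ▸ h3)

theorem coeffL_eq_zero_of_mem_sq {f : semigroupRing k H}
    (hf : f ∈ maximalIdeal (semigroupRing k H) ^ 2) {a : ℕ}
    (ha : ∀ h ∈ H, ∀ h' ∈ H, h + h' = a → h = 0 ∨ h' = 0) : coeffL k H a f = 0 := by
  by_contra h
  obtain ⟨i, hi, j, hj, hi0, hj0, e⟩ := exists_add_of_mem_sq hf h
  have := ha i hi j hj e.symm
  omega

theorem coeffL_zero_eq_zero_of_mem_sq {f : semigroupRing k H}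
    (hf : f ∈ maximalIdeal (semigroupRing k H) ^ 2) : coeffL k H 0 f = 0 :=
  coeffL_eq_zero_of_mem_sq hf fun h _ h' _ e => by omega

theorem coeffL_two_mul_eq_zero_of_mem_cube (hH : MinimallyGenerated H a₁ a₂ a₃)
    {f : semigroupRing k H} (hf : f ∈ maximalIdeal (semigroupRing k H) ^ 3) :
    coeffL k H (2 * a₁) f = 0 := by
  by_contra h
  obtain ⟨i, hi, j, hj, l, hl, hi0, hj0, hl0, e⟩ := exists_add_add_of_mem_cube hf h
  have := hH.le_of_mem hi hi0
  have := hH.le_of_mem hj hj0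
  have := hH.le_of_mem hl hl0
  have := hH.pos
  omega

end SemigroupRing

/-! ### The two choices of functional -/

namespace SemigroupRing

open PowerSeries

variable {k : Type*} [Field k] {H : AddSubmonoid ℕ} {a₁ a₂ a₃ : ℕ}

theorem tpow_two_mul_mem_sq (hH : MinimallyGenerated H a₁ a₂ a₃) :
    tpow k (⟨2 * a₁, hH.mul_mem 2⟩ : H) ∈ maximalIdeal (semigroupRing k H) ^ 2 := by
  have hp := hH.pos
  refine mem_sq_of_forall hH fun n hn => ⟨a₁, hH.mem₁, a₁, hH.mem₁, by omega, by omega, ?_⟩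
  rw [coeffL_tpow] at hn
  have : n = 2 * a₁ := by
    by_contra h
    simp [h] at hn
  omega

theorem orderGE_le_functionalIdeal {l : semigroupRing k H →ₗ[k] k} {N : ℕ}
    (hl : ∀ f ∈ orderGE k H N, l f = 0) : orderGE k H N ≤ functionalIdeal l :=
  fun _ hf g => hl _ (Ideal.mul_mem_left _ g hf)

/-- The case in which `a₂ + a₃` is a multiple of `a₁`. -/
theorem isCanonicalStretched_of_add_eq_mul (hH : MinimallyGenerated H a₁ a₂ a₃) {c s : ℕ}
    (hc : ∀ n ≥ c, n ∈ H) (hs : a₂ + a₃ = s * a₁) : IsCanonicalStretched (semigroupRing k H) := by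
  have hp := hH.pos
  have h12 := hH.lt₁₂
  have h23 := hH.lt₂₃
  have hs3 : 3 ≤ s := by
    by_contra h
    have : s * a₁ ≤ 2 * a₁ := Nat.mul_le_mul_right _ (by omega)
    omega
  obtain ⟨s, rfl⟩ : ∃ s', s = s' + 2 := ⟨s - 2, by omega⟩
  have hs2 : (s + 2) * a₁ = s * a₁ + 2 * a₁ := by ring
  have hs1 : (s + 1) * a₁ = s * a₁ + a₁ := by ring
  set l := coeffL k H (a₂ + a₃) with hl
  -- Pairing with `t^h` reads off the coefficient at the complementary summand.
  have htest : ∀ f ∈ functionalIdeal l, ∀ h h' : ℕ, h ∈ H → h + h' = a₂ + a₃ →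
      coeffL k H h' f = 0 := by
    intro f hf h h' hh e
    have := hf (tpow k (⟨h, hh⟩ : H))
    rw [hl, coeffL_tpow_mul, if_pos (by simp only []; omega)] at this
    simpa [show a₂ + a₃ - h = h' by omega] using this
  have hzero : ∀ q : semigroupRing k H, coeffL k H a₂ q = 0 → coeffL k H a₃ q = 0 →
      (∀ i, coeffL k H (i * a₁) q = 0) → q ∈ functionalIdeal l := by
    intro q h2 h3 hi g
    by_contra h
    obtain ⟨i, j, e, hgi, hqj⟩ := exists_of_coeffL_mul_ne_zero h
    obtain h0 | h0 | h0 | h0 | ⟨r, -, h0⟩ := hH.summand_of_add_eq (mem_of_coeffL_ne_zero hqj)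
      (mem_of_coeffL_ne_zero hgi) (by omega)
    · exact hqj (by simpa [h0] using hi 0)
    · exact hqj (h0 ▸ h2)
    · exact hqj (h0 ▸ h3)
    · refine hqj ?_
      rw [show j = (s + 2) * a₁ by omega]
      exact hi _
    · exact hqj (h0 ▸ hi r)
  refine isCanonicalStretched_of_functional (isCohenMacaulayLocal hc)
    exists_sub_algebraMap_mem_maximalIdeal (l := l) ?_
    (isArtinianRing_quotient_of_orderGE_le (M := a₂ + a₃ + 1)
      (orderGE_le_functionalIdeal fun f hf => mem_orderGE.mp hf _ (by omega))) ?_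
    (tpow_two_mul_mem_sq hH) ?_ ?_
  · intro h
    have h1 := coeffL_tpow (k := k) (⟨a₂ + a₃, H.add_mem hH.mem₂ hH.mem₃⟩ : H) (a₂ + a₃)
    rw [← hl, h] at h1
    simp at h1
  · intro f hf
    exact mem_sq_of_coeff_eq_zero hH
      (htest f hf (a₂ + a₃) 0 (H.add_mem hH.mem₂ hH.mem₃) (by omega))
      (htest f hf ((s + 1) * a₁) a₁ (hH.mul_mem _) (by omega))
      (htest f hf a₃ a₂ hH.mem₃ (by omega)) (htest f hf a₂ a₃ hH.mem₂ rfl)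
  · intro h
    obtain ⟨p, hp, q, hq, e⟩ := Submodule.mem_sup.mp h
    have h1 := coeffL_two_mul_eq_zero_of_mem_cube hH hp
    have h2 := htest q hq (s * a₁) (2 * a₁) (hH.mul_mem _) (by omega)
    have h3 := coeffL_tpow (k := k) (⟨2 * a₁, hH.mul_mem 2⟩ : H) (2 * a₁)
    rw [← e, map_add, h1, h2] at h3
    simp at h3
  · intro f hf
    classical
    refine ⟨coeffL k H (2 * a₁) f, ?_⟩
    have hf0 := coeffL_zero_eq_zero_of_mem_sq hf
    have hf1 := coeffL_eq_zero_of_mem_sq hf hH.irred₁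
    have hf2 := coeffL_eq_zero_of_mem_sq hf hH.irred₂
    have hf3 := coeffL_eq_zero_of_mem_sq hf hH.irred₃
    -- `p` is the part of `f` at the exponents `i a₁` with `i ≥ 3`; it lies in `t^a₁ 𝔫²`. Without
    -- `p` and the `t^(2a₁)` term, `f` has no coefficient at a summand of `a₂ + a₃`, so the rest
    -- lies in the ideal.
    let p : semigroupRing k H := ⟨PowerSeries.mk fun n =>
        if ∃ i, 3 ≤ i ∧ n = i * a₁ then coeffL k H n f else 0, by
      intro n hn
      rw [coeff_mk] at hn
      by_contra h
      have : coeffL k H n f = 0 := by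
        by_contra h'
        exact h (mem_of_coeffL_ne_zero h')
      simp [this] at hn⟩
    have hpc : ∀ n, coeffL k H n p = if ∃ i, 3 ≤ i ∧ n = i * a₁ then coeffL k H n f else 0 :=
      fun n => PowerSeries.coeff_mk n fun n =>
        if ∃ i, 3 ≤ i ∧ n = i * a₁ then coeffL k H n f else 0
    have hp3 : p ∈ maximalIdeal (semigroupRing k H) ^ 3 := by
      rw [pow_succ]
      refine mem_mul_of_forall_exists_add _ _ {n | ∃ i, n = (i + 2) * a₁} ?_ ?_
        {⟨a₁, hH.mem₁⟩} ?_ p ?_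
      · rintro _ ⟨i, rfl⟩
        exact hH.mul_mem _
      · intro g hg
        refine mem_sq_of_forall hH fun n hn => ?_
        obtain ⟨i, rfl⟩ := hg n hn
        exact ⟨a₁, hH.mem₁, (i + 1) * a₁, hH.mul_mem _, by omega,
          Nat.mul_ne_zero (by omega) (by omega), by ring⟩
      · intro b hb
        rw [Finset.mem_singleton.mp hb]
        exact tpow_mem_maximalIdeal (by simp only []; omega)
      · intro n hn
        rw [← coeffL_apply, hpc] at hn
        obtain ⟨i, hi, rfl⟩ : ∃ i, 3 ≤ i ∧ n = i * a₁ := by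
          by_contra h
          simp [h] at hn
        obtain ⟨i, rfl⟩ := Nat.exists_eq_add_of_le hi
        exact ⟨_, Finset.mem_singleton_self _, (i + 2) * a₁, ⟨i, rfl⟩, by simp only []; ring⟩
    have hne : ∀ a, (∀ i, a ≠ i * a₁) → coeffL k H a f = 0 → coeffL k H a
        (f - coeffL k H (2 * a₁) f • tpow k (⟨2 * a₁, hH.mul_mem 2⟩ : H) - p) = 0 := by
      intro a ha ha0
      have h1 : ¬ ∃ i, 3 ≤ i ∧ a = i * a₁ := fun ⟨i, _, hi⟩ => ha i hi
      rw [map_sub, map_sub, map_smul, hpc, if_neg h1, coeffL_tpow, if_neg (ha 2), ha0]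
      simp
    rw [Submodule.mem_sup]
    refine ⟨p, hp3, _, hzero _ (hne _ hH.ne_mul₂ hf2) (hne _ hH.ne_mul₃ hf3) ?_,
      add_sub_cancel p _⟩
    intro i
    have hinj : ∀ i j, i * a₁ = j * a₁ ↔ i = j := fun i j => Nat.mul_left_inj (by omega)
    rw [map_sub, map_sub, map_smul, hpc, coeffL_tpow]
    simp only [hinj, exists_eq_right', smul_eq_mul]
    obtain _ | _ | _ | i := i
    · simp [hf0]
    · simp [hf1]
    · simp
    · simp

/-- The case in which `a₂ + a₃` is not a multiple of `a₁`. -/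
theorem isCanonicalStretched_of_add_ne_mul (hH : MinimallyGenerated H a₁ a₂ a₃) {c : ℕ}
    (hc : ∀ n ≥ c, n ∈ H) (hs : ∀ s, a₂ + a₃ ≠ s * a₁) :
    IsCanonicalStretched (semigroupRing k H) := by
  have hp := hH.pos
  have h12 := hH.lt₁₂
  have h23 := hH.lt₂₃
  have hn2 := hH.ne_mul₂
  have hn3 := hH.ne_mul₃
  set l := coeffL k H (2 * a₁) + coeffL k H (a₂ + a₃) with hl
  have hl' : ∀ f, l f = coeffL k H (2 * a₁) f + coeffL k H (a₂ + a₃) f := fun _ => rfl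
  have hsupp : ∀ (f : semigroupRing k H) (n : ℕ), n ∉ H → coeffL k H n f = 0 := by
    intro f n hn
    by_contra h
    exact hn (mem_of_coeffL_ne_zero h)
  have htest : ∀ f ∈ functionalIdeal l, ∀ h : H,
      (if (h : ℕ) ≤ 2 * a₁ then coeffL k H (2 * a₁ - h) f else 0) +
        (if (h : ℕ) ≤ a₂ + a₃ then coeffL k H (a₂ + a₃ - h) f else 0) = 0 := by
    intro f hf h
    rw [← coeffL_tpow_mul, ← coeffL_tpow_mul, ← hl']
    exact hf _
  -- Only multiples of `a₁` are summands of `2a₁`, so tests by `t^a₂` and `t^a₃` see only the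
  -- coefficient at `a₂ + a₃`.
  have h2a : ∀ (f : semigroupRing k H) (a : ℕ), a ∈ H → (∀ i, a ≠ i * a₁) →
      (if a ≤ 2 * a₁ then coeffL k H (2 * a₁ - a) f else 0) = 0 := by
    intro f a ha hai
    split_ifs with hle
    · refine hsupp f _ fun h => ?_
      obtain h0 | h0 | h0 := hH.eq_zero_or_eq_of_add_eq_two_mul ha h (by omega)
      · exact hai 0 (by omega)
      · exact hai 1 (by omega)
      · exact hai 2 h0
    · rfl
  have hzero : ∀ q : semigroupRing k H, coeffL k H 0 q = 0 → coeffL k H a₁ q = 0 →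
      coeffL k H a₂ q = 0 → coeffL k H a₃ q = 0 → l q = 0 → q ∈ functionalIdeal l := by
    intro q h0 h1 h2 h3 hlq g
    -- The constant term of `g` contributes `d • l q = 0`; the rest pairs `q` only at proper
    -- summands of `2a₁` and `a₂ + a₃`.
    obtain ⟨d, hd⟩ := exists_sub_algebraMap_mem_maximalIdeal g
    have hg : g * q = (g - algebraMap k _ d) * q + d • q := by
      rw [Algebra.smul_def]
      ring
    generalize g - algebraMap k _ d = g' at hd hg
    rw [mem_maximalIdeal] at hd
    rw [hg, map_add, map_smul, hlq, smul_zero, add_zero, hl']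
    have e1 : coeffL k H (2 * a₁) (g' * q) = 0 := by
      by_contra h
      obtain ⟨i, j, e, hgi, hqj⟩ := exists_of_coeffL_mul_ne_zero h
      obtain h' | h' | h' := hH.eq_zero_or_eq_of_add_eq_two_mul (mem_of_coeffL_ne_zero hqj)
        (mem_of_coeffL_ne_zero hgi) (by omega)
      · exact hqj (h' ▸ h0)
      · exact hqj (h' ▸ h1)
      · exact hgi ((show i = 0 by omega) ▸ hd)
    have e2 : coeffL k H (a₂ + a₃) (g' * q) = 0 := by
      by_contra h
      obtain ⟨i, j, e, hgi, hqj⟩ := exists_of_coeffL_mul_ne_zero h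
      obtain h' | h' | h' | h' := hH.summand_of_add_eq_of_ne hs (mem_of_coeffL_ne_zero hqj)
        (mem_of_coeffL_ne_zero hgi) (by omega)
      · exact hqj (h' ▸ h0)
      · exact hqj (h' ▸ h2)
      · exact hqj (h' ▸ h3)
      · exact hgi (h' ▸ hd)
    rw [e1, e2, add_zero]
  have hly : l (tpow k (⟨2 * a₁, hH.mul_mem 2⟩ : H)) = 1 := by
    rw [hl', coeffL_tpow, coeffL_tpow, if_pos rfl, if_neg (hs 2), add_zero]
  refine isCanonicalStretched_of_functional (isCohenMacaulayLocal hc)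
    exists_sub_algebraMap_mem_maximalIdeal (l := l) ?_
    (isArtinianRing_quotient_of_orderGE_le (M := a₂ + a₃ + 1)
      (orderGE_le_functionalIdeal fun f hf => ?_)) ?_
    (tpow_two_mul_mem_sq hH) ?_ ?_
  · intro h
    rw [h] at hly
    simp at hly
  · rw [hl', coeffL_apply, coeffL_apply, mem_orderGE.mp hf _ (by omega),
      mem_orderGE.mp hf _ (by omega), add_zero]
  · intro f hf
    refine mem_sq_of_coeff_eq_zero hH ?_ ?_ ?_ ?_
    · have := htest f hf ⟨a₂ + a₃, H.add_mem hH.mem₂ hH.mem₃⟩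
      rw [if_neg (by simp only []; omega), if_pos le_rfl, zero_add, Nat.sub_self] at this
      exact this
    · have := htest f hf ⟨a₁, hH.mem₁⟩
      simp only [] at this
      rw [if_pos (by omega), show 2 * a₁ - a₁ = a₁ by omega, if_pos (by omega),
        hsupp f (a₂ + a₃ - a₁), add_zero] at this
      · exact this
      -- If `a₂ + a₃ - a₁` were in `H`, then `a₁` would be a summand of `a₂ + a₃`.
      · intro h
        have := hH.summand_of_add_eq_of_ne hs hH.mem₁ h (by omega)
        omega
    · have := htest f hf ⟨a₃, hH.mem₃⟩
      simp only [] at this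
      rwa [h2a f a₃ hH.mem₃ hn3, zero_add, if_pos (by omega), Nat.add_sub_cancel] at this
    · have := htest f hf ⟨a₂, hH.mem₂⟩
      simp only [] at this
      rwa [h2a f a₂ hH.mem₂ hn2, zero_add, if_pos (by omega), Nat.add_sub_cancel_left] at this
  · intro h
    obtain ⟨p, hp, q, hq, e⟩ := Submodule.mem_sup.mp h
    have h1 := coeffL_two_mul_eq_zero_of_mem_cube hH hp
    -- Neither `2a₁` nor `a₂ + a₃` is a sum of three nonzero elements of `H`, so `l` kills `𝔫³`,
    -- whereas `l y = 1`.
    have h2 : coeffL k H (a₂ + a₃) p = 0 := by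
      by_contra h
      obtain ⟨i, hi, j, hj, r, hr, hi0, hj0, hr0, e⟩ := exists_add_add_of_mem_cube hp h
      exact hH.add_add_ne_of_ne hs hi hj hr hi0 hj0 hr0 e.symm
    have h3 : l q = 0 := by simpa using hq 1
    rw [← e, map_add, h3, hl', h1, h2] at hly
    simp at hly
  · intro f hf
    -- Since `l y = 1`, subtracting `l f • y` already lands in the ideal, with no term from `𝔫³`.
    refine ⟨l f, Ideal.mem_sup_right ?_⟩
    have hf0 := coeffL_zero_eq_zero_of_mem_sq hf
    have hf1 := coeffL_eq_zero_of_mem_sq hf hH.irred₁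
    have hf2 := coeffL_eq_zero_of_mem_sq hf hH.irred₂
    have hf3 := coeffL_eq_zero_of_mem_sq hf hH.irred₃
    refine hzero _ ?_ ?_ ?_ ?_ ?_
    · rw [map_sub, map_smul, coeffL_tpow, hf0, if_neg (by simp only []; omega)]; simp
    · rw [map_sub, map_smul, coeffL_tpow, hf1, if_neg (by simp only []; omega)]; simp
    · rw [map_sub, map_smul, coeffL_tpow, hf2, if_neg (hn2 2)]; simp
    · rw [map_sub, map_smul, coeffL_tpow, hf3, if_neg (hn3 2)]; simp
    · rw [map_sub, map_smul, hly]; simp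

theorem isCanonicalStretched_of_minimallyGenerated (hH : MinimallyGenerated H a₁ a₂ a₃) {c : ℕ}
    (hc : ∀ n ≥ c, n ∈ H) : IsCanonicalStretched (semigroupRing k H) := by
  by_cases h : ∃ s, a₂ + a₃ = s * a₁
  · obtain ⟨s, hs⟩ := h
    exact isCanonicalStretched_of_add_eq_mul hH hc hs
  · push Not at h
    exact isCanonicalStretched_of_add_ne_mul hH hc h

/-- If every nonzero element of `H` lies in `b + H` for some `b` in a finite set of nonzero
elements, then the embedding dimension is at most the size of this set. -/
theorem embDim_le_card {c : ℕ} (hc : ∀ n ≥ c, n ∈ H) (B : Finset H) (hB0 : ∀ b ∈ B, (b : ℕ) ≠ 0)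
    (hB : ∀ h ∈ H, h ≠ 0 → ∃ b ∈ B, ∃ r ∈ H, h = b + r) : embDim (semigroupRing k H) ≤ B.card := by
  classical
  have := isNoetherianRing (k := k) hc
  have hspan : maximalIdeal (semigroupRing k H) = Ideal.span (B.image (tpow k) : Set _) := by
    refine le_antisymm (fun f hf => ?_) (Ideal.span_le.mpr ?_)
    · rw [← Ideal.top_mul (Ideal.span _)]
      refine mem_mul_of_forall_exists_add _ _ (H : Set ℕ) subset_rfl
        (fun _ _ => Submodule.mem_top) B
        (fun b hb => Ideal.subset_span (Finset.mem_coe.mpr (Finset.mem_image_of_mem _ hb))) f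
        fun n hn => hB n (mem_of_coeff_ne_zero f hn) ?_
      rintro rfl
      exact hn (mem_maximalIdeal.mp hf)
    · intro x hx
      obtain ⟨b, hb, rfl⟩ := Finset.mem_image.mp (Finset.mem_coe.mp hx)
      exact tpow_mem_maximalIdeal (hB0 b hb)
  rw [embDim, Module.finrank,
    IsLocalRing.rank_cotangentSpace_eq_spanrank_maximalIdeal_of_fg (IsNoetherian.noetherian _),
    ← Submodule.spanFinrank, hspan]
  refine (Submodule.spanFinrank_span_le_ncard_of_finite (Finset.finite_toSet _)).trans ?_
  rw [Set.ncard_coe_finset]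
  exact Finset.card_image_le

end SemigroupRing

open SemigroupRing in
-- A generator that decomposes is redundant: the other two then generate `H`, and the embedding
-- dimension is at most two.
theorem minimallyGenerated_of_embDim_eq_three {k : Type*} [Field k] {a₁ a₂ a₃ : ℕ} (h₁ : 0 < a₁)
    (h₁₂ : a₁ < a₂) (h₂₃ : a₂ < a₃) {c : ℕ}
    (hc : ∀ n ≥ c, n ∈ AddSubmonoid.closure ({a₁, a₂, a₃} : Set ℕ))
    (hedim : embDim (semigroupRing k (AddSubmonoid.closure {a₁, a₂, a₃})) = 3) :
    MinimallyGenerated (AddSubmonoid.closure {a₁, a₂, a₃}) a₁ a₂ a₃ := by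
  classical
  set H := AddSubmonoid.closure ({a₁, a₂, a₃} : Set ℕ) with hHdef
  have m1 : a₁ ∈ H := AddSubmonoid.subset_closure (by simp)
  have m2 : a₂ ∈ H := AddSubmonoid.subset_closure (by simp)
  have m3 : a₃ ∈ H := AddSubmonoid.subset_closure (by simp)
  have gen : ∀ h ∈ H, h = 0 ∨ ∃ r ∈ H, h = a₁ + r ∨ h = a₂ + r ∨ h = a₃ + r := by
    intro h hh
    induction hh using AddSubmonoid.closure_induction with
    | mem x hx =>
      refine Or.inr ⟨0, H.zero_mem, ?_⟩
      simpa using hx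
    | zero => exact Or.inl rfl
    | add x y hx hy ihx ihy =>
      obtain h0 | ⟨r, hr, h0⟩ := ihx
      · simpa [h0] using ihy
      · exact Or.inr ⟨r + y, H.add_mem hr hy, by omega⟩
  have key : ∀ a b d : ℕ, 0 < b → 0 < d → b ∈ H → d ∈ H →
      (∀ h ∈ H, h = 0 ∨ ∃ r ∈ H, h = a + r ∨ h = b + r ∨ h = d + r) →
      ∀ h ∈ H, ∀ h' ∈ H, h + h' = a → h = 0 ∨ h' = 0 := by
    intro a b d hb0 hd0 hb hd hgen h hh h' hh' e
    by_contra! hne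
    -- In a proper decomposition `a = h + h'`, the summand `h` is smaller than `a`, so it starts
    -- with `b` or `d`.
    have ha : ∃ r ∈ H, a = b + r ∨ a = d + r := by
      obtain h0 | ⟨r, hr, h0 | h0 | h0⟩ := hgen h hh
      · exact absurd h0 hne.1
      · omega
      · exact ⟨r + h', H.add_mem hr hh', by omega⟩
      · exact ⟨r + h', H.add_mem hr hh', by omega⟩
    obtain ⟨r, hr, ha⟩ := ha
    have := embDim_le_card (k := k) hc {⟨b, hb⟩, ⟨d, hd⟩} (by
      intro x hx
      simp only [Finset.mem_insert, Finset.mem_singleton] at hx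
      rcases hx with rfl | rfl <;> simp only [] <;> omega) (by
      intro x hx hx0
      suffices ∃ r ∈ H, x = b + r ∨ x = d + r by
        obtain ⟨r, hr, h0 | h0⟩ := this
        · exact ⟨⟨b, hb⟩, by simp, r, hr, h0⟩
        · exact ⟨⟨d, hd⟩, by simp, r, hr, h0⟩
      obtain h0 | ⟨s, hs, h0 | h0⟩ := hgen x hx
      · exact absurd h0 hx0
      · exact ⟨r + s, H.add_mem hr hs, by omega⟩
      · exact ⟨s, hs, h0⟩)
    have h2 := Finset.card_le_two (a := (⟨b, hb⟩ : H)) (b := ⟨d, hd⟩)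
    omega
  exact ⟨h₁, h₁₂, h₂₃, m1, m2, m3, gen,
    key a₁ a₂ a₃ (by omega) (by omega) m2 m3 gen,
    key a₂ a₁ a₃ (by omega) (by omega) m1 m3 fun h hh => (gen h hh).imp_right
      fun ⟨r, hr, h0⟩ => ⟨r, hr, by omega⟩,
    key a₃ a₁ a₂ (by omega) (by omega) m1 m2 fun h hh => (gen h hh).imp_right
      fun ⟨r, hr, h0⟩ => ⟨r, hr, by omega⟩⟩

/-- If `a₂ + a₃ = s a₁` for some `s`, the irreducible ideal consists of the series `f` such that
the coefficient of `t^(s a₁)` in `f g` vanishes for all `g`; otherwise the same with the sum of the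
coefficients of `t^(2 a₁)` and `t^(a₂ + a₃)`. This works for any `S` of embedding dimension three:
the non-Gorenstein hypothesis is not needed. -/
theorem theorem5p1 {k : Type*} [Field k] (a₁ a₂ a₃ : ℕ) (h₁ : 0 < a₁) (h₁₂ : a₁ < a₂)
    (h₂₃ : a₂ < a₃) (hgcd : Nat.gcd (Nat.gcd a₁ a₂) a₃ = 1)
    (hedim : embDim (semigroupRing k (AddSubmonoid.closure {a₁, a₂, a₃})) = 3)
    (hGor : ¬ IsGorensteinLocal (semigroupRing k (AddSubmonoid.closure {a₁, a₂, a₃}))) :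
    IsCanonicalStretched (semigroupRing k (AddSubmonoid.closure {a₁, a₂, a₃})) := by
  obtain ⟨c, hc⟩ := Nat.exists_mem_closure_of_ge ({a₁, a₂, a₃} : Set ℕ)
  have hd : Nat.setGcd ({a₁, a₂, a₃} : Set ℕ) = 1 := by
    rw [← Nat.dvd_one, ← hgcd]
    exact Nat.dvd_gcd (Nat.dvd_gcd (Nat.setGcd_dvd_of_mem (by simp))
      (Nat.setGcd_dvd_of_mem (by simp))) (Nat.setGcd_dvd_of_mem (by simp))
  have hc' : ∀ n ≥ c, n ∈ AddSubmonoid.closure ({a₁, a₂, a₃} : Set ℕ) :=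
    fun n hn => hc n hn (hd ▸ one_dvd n)
  exact SemigroupRing.isCanonicalStretched_of_minimallyGenerated
    (minimallyGenerated_of_embDim_eq_three h₁ h₁₂ h₂₃ hc' hedim) hc'
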